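/- Let $N_1,N_2,\dots\ge 2$ be integers and let $B_n\subset\{0,1,\dots,N_n-1\}$ be sets with $0\in B_n$ for all $n\ge 1$. For a finite nonempty set $A\subset\mathbb R$ put $\delta_A=\frac1{\#A}\sum_{a\in A}\delta_a$. The Cantor–Moran measure generated by $\{(N_n,B_n)\}$ is the infinite convolution (weak limit of the finite convolutions) $$\mu(N_n,B_n)=\delta_{\frac1{N_1}B_1}*\delta_{\frac1{N_1N_2}B_2}*\delta_{\frac1{N_1N_2N_3}B_3}*\cdots.$$ For $n\ge 0$ let $\mu_{>n}$ be the convolution of all these factors except the first $n$, and let $\nu_{>n}(E)=\mu_{>n}\big((N_1\cdots N_n)^{-1}E\big)$ for Borel sets $E\subset\mathbb R$. For a Borel probability measure $\nu$ on $\mathbb R$ let $\widehat\nu(\xi)=\int e^{-2\pi i\xi x}\,d\nu(x)$, and let $\rho=\frac12(\delta_0+\delta_1)$. A collection $\Phi$ of probability measures on $[0,1]$ is called equi-positive if there is $\epsilon_0>0$ such that for all $x\in[0,1]$ and all $\nu\in\Phi$ there is $k_{x,\nu}\in\mathbb Z$ with $|\widehat\nu(x+k_{x,\nu})|\ge\epsilon_0$.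 **Theorem 1.7.** (i) There exists a Cantor–Moran measure $\mu(N_n,B_n)$ such that the associated sequence $\{\nu_{>n}\}$ has no equi-positive subsequence. (ii) There exists a Cantor–Moran measure $\mu(N_n,B_n)$ such that the associated measures $\nu_{>n}$ are all supported in $[0,1]$, $\{\nu_{>n}\}$ converges weakly to $\rho$, and $\{\widehat{\nu_{>n}}\}$ converges to $\widehat\rho$ uniformly on the non-compact set $\frac12+\mathbb Z$. -/

import Mathlib

open MeasureTheory Filter Topology

noncomputable section

/-- The uniform discrete measure `δ_A = (1 / #A) ∑_{a ∈ A} δ_a` on a finite set `A` of reals. -/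
def uniformDirac (A : Finset ℝ) : Measure ℝ :=
  (A.card : ENNReal)⁻¹ • ∑ a ∈ A, Measure.dirac a

theorem isProbabilityMeasure_uniformDirac {A : Finset ℝ} (hA : A.Nonempty) :
    IsProbabilityMeasure (uniformDirac A) := by
  refine ⟨?_⟩
  have h0 : (A.card : ENNReal) ≠ 0 := by
    exact_mod_cast hA.card_ne_zero
  simp [uniformDirac, ENNReal.inv_mul_cancel h0 (ENNReal.natCast_ne_top _)]

theorem ae_uniformDirac {A : Finset ℝ} {p : ℝ → Prop} (hp : ∀ a ∈ A, p a) :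
    ∀ᵐ x ∂(uniformDirac A), p x := by
  have h : ∀ᵐ x ∂(∑ a ∈ A, Measure.dirac a : Measure ℝ), p x := by
    rw [ae_iff, Measure.coe_finsetSum, Finset.sum_apply]
    refine Finset.sum_eq_zero fun a ha => ?_
    rw [← ae_iff, ae_dirac_eq]
    exact hp a ha
  exact Measure.ae_smul_measure h _

/-- `finConv μ n = μ 0 ∗ μ 1 ∗ ⋯ ∗ μ (n - 1)`; the empty convolution is the Dirac mass at `0`. -/
def finConv (μ : ℕ → ProbabilityMeasure ℝ) : ℕ → ProbabilityMeasure ℝ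
  | 0 => ⟨Measure.dirac 0, inferInstance⟩
  | n + 1 => ⟨(finConv μ n : Measure ℝ).conv (μ n : Measure ℝ), inferInstance⟩

/-- The infinite convolution `μ 0 ∗ μ 1 ∗ μ 2 ∗ ⋯`: the weak limit of the finite convolutions. -/
def infConv (μ : ℕ → ProbabilityMeasure ℝ) : ProbabilityMeasure ℝ :=
  limUnder atTop (finConv μ)

/-- The infinite convolution exists as soon as the factors live on summably small intervals. -/
theorem tendsto_infConv (μ : ℕ → ProbabilityMeasure ℝ) (c : ℕ → ℝ) (hc : Summable c)
    (h : ∀ j, ∀ᵐ x ∂(μ j : Measure ℝ), ‖x‖ ≤ c j) :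
    Tendsto (finConv μ) atTop (𝓝 (infConv μ)) := by
  refine tendsto_nhds_limUnder ?_
  let P : Measure (ℕ → ℝ) := Measure.infinitePi fun j => (μ j : Measure ℝ)
  have hmp : ∀ j, MeasurePreserving (fun ω : ℕ → ℝ => ω j) P (μ j : Measure ℝ) := fun j =>
    measurePreserving_eval_infinitePi _ j
  have hind : ProbabilityTheory.iIndepFun (fun (j : ℕ) (ω : ℕ → ℝ) => ω j) P :=
    ProbabilityTheory.iIndepFun_infinitePi (X := fun _ x => x) (by fun_prop)
  let S : ℕ → (ℕ → ℝ) → ℝ := fun n => ∑ j ∈ Finset.range n, fun ω : ℕ → ℝ => ω j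
  have hSm : ∀ n, Measurable (S n) := fun n => by
    have : S n = fun ω => ∑ j ∈ Finset.range n, ω j := by ext ω; simp [S]
    rw [this]
    fun_prop
  have hlaw : ∀ n, P.map (S n) = (finConv μ n : Measure ℝ) := by
    intro n
    induction n with
    | zero =>
      have : S 0 = fun _ => 0 := by ext; simp [S]
      rw [this, Measure.map_const]
      simp [finConv]
    | succ n ih =>
      have hi : ProbabilityTheory.IndepFun (S n) (fun ω : ℕ → ℝ => ω n) P :=
        hind.indepFun_finsetSum_of_notMem (fun j => measurable_pi_apply j)
          (Finset.notMem_range_self)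
      have hs : S (n + 1) = S n + fun ω : ℕ → ℝ => ω n := by
        simp [S, Finset.sum_range_succ]
      rw [hs, hi.map_add_eq_map_conv_map (hSm n) (measurable_pi_apply n), ih, (hmp n).map_eq]
      rfl
  have hsum : ∀ᵐ ω ∂P, Summable fun j => ω j := by
    have : ∀ᵐ ω ∂P, ∀ j, ‖ω j‖ ≤ c j := ae_all_iff.2 fun j =>
      (hmp j).quasiMeasurePreserving.ae (h j)
    filter_upwards [this] with ω hω
    exact Summable.of_norm_bounded hc hω
  have htend : ∀ᵐ ω ∂P, Tendsto (fun n => S n ω) atTop (𝓝 (∑' j, ω j)) := by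
    filter_upwards [hsum] with ω hω
    simpa [S] using hω.hasSum.tendsto_sum_nat
  have hZ : AEMeasurable (fun ω : ℕ → ℝ => ∑' j, ω j) P :=
    aemeasurable_of_tendsto_metrizable_ae atTop (fun n => (hSm n).aemeasurable) htend
  have hd := tendstoInDistribution_of_ae_tendsto (fun n => (hSm n).aemeasurable) hZ htend
  refine ⟨_, hd.tendsto.congr fun n => ?_⟩
  exact Subtype.ext (hlaw n)

/-- The data `(N_n, B_n)`, `n = 1, 2, …`, generating a Cantor–Moran measure in `[0, 1]`.
The sequences are indexed from `0` here: `N i` and `B i` stand for `N_{i+1}` and `B_{i+1}`. -/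
structure CantorMoranData where
  /-- the scaling factors -/
  N : ℕ → ℕ
  /-- the digit sets -/
  B : ℕ → Finset ℕ
  two_le : ∀ i, 2 ≤ N i
  digit_lt : ∀ i, ∀ b ∈ B i, b < N i
  zero_mem : ∀ i, 0 ∈ B i

namespace CantorMoranData

/-- The product `N_1 N_2 ⋯ N_n` of the first `n` scaling factors. -/
def prodN (D : CantorMoranData) (n : ℕ) : ℕ := ∏ i ∈ Finset.range n, D.N i

/-- The finite set `(1 / (N_1 ⋯ N_{i+1})) B_{i+1}` of reals. -/
def scaledDigits (D : CantorMoranData) (i : ℕ) : Finset ℝ :=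
  (D.B i).image fun b : ℕ => (b : ℝ) / (D.prodN (i + 1) : ℝ)

theorem scaledDigits_nonempty (D : CantorMoranData) (i : ℕ) : (D.scaledDigits i).Nonempty :=
  Finset.Nonempty.image ⟨0, D.zero_mem i⟩ _

/-- The convolution factor `δ_{(1 / (N_1 ⋯ N_{i+1})) B_{i+1}}`. -/
def factor (D : CantorMoranData) (i : ℕ) : ProbabilityMeasure ℝ :=
  ⟨uniformDirac (D.scaledDigits i), isProbabilityMeasure_uniformDirac (D.scaledDigits_nonempty i)⟩

/-- The Cantor–Moran measure
`μ(N_n, B_n) = δ_{(1/N_1) B_1} ∗ δ_{(1/(N_1 N_2)) B_2} ∗ δ_{(1/(N_1 N_2 N_3)) B_3} ∗ ⋯`. -/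
def measure (D : CantorMoranData) : ProbabilityMeasure ℝ := infConv D.factor

/-- The tail `μ_{>n}`: the infinite convolution of all factors but the first `n`. -/
def tail (D : CantorMoranData) (n : ℕ) : ProbabilityMeasure ℝ :=
  infConv fun j => D.factor (n + j)

theorem tail_zero (D : CantorMoranData) : D.tail 0 = D.measure := by
  simp [tail, measure]

/-- The rescaled tail `ν_{>n}`, with `ν_{>n}(E) = μ_{>n}((N_1 ⋯ N_n)⁻¹ E)`: the image of `μ_{>n}`
under `x ↦ N_1 ⋯ N_n x`. -/
def nu (D : CantorMoranData) (n : ℕ) : ProbabilityMeasure ℝ :=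
  (D.tail n).map (f := fun x : ℝ => (D.prodN n : ℝ) * x) (by fun_prop)

theorem two_pow_le_prodN (D : CantorMoranData) (n : ℕ) : 2 ^ n ≤ D.prodN n := by
  have := Finset.prod_le_prod' (s := Finset.range n) (f := fun _ => 2) (g := D.N)
    fun i _ => D.two_le i
  simpa [prodN] using this

theorem ae_factor_norm_le (D : CantorMoranData) (i : ℕ) :
    ∀ᵐ x ∂(D.factor i : Measure ℝ), ‖x‖ ≤ (1 / 2 : ℝ) ^ i := by
  refine ae_uniformDirac fun a ha => ?_
  obtain ⟨b, hb, rfl⟩ := Finset.mem_image.1 ha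
  have hP : (2 : ℝ) ^ i ≤ D.prodN i := by exact_mod_cast D.two_pow_le_prodN i
  have hP0 : (0 : ℝ) < D.prodN i := lt_of_lt_of_le (by positivity) hP
  have hN0 : (0 : ℝ) < D.N i := by
    have := D.two_le i
    exact_mod_cast (by omega : 0 < D.N i)
  have hbN : (b : ℝ) ≤ D.N i := by exact_mod_cast (D.digit_lt i b hb).le
  have hs : (D.prodN (i + 1) : ℝ) = D.prodN i * D.N i := by
    simp [prodN, Finset.prod_range_succ]
  rw [Real.norm_of_nonneg (by positivity), hs, div_le_iff₀ (by positivity)]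
  have h1 : (1 : ℝ) ≤ (1 / 2) ^ i * D.prodN i := by
    rw [one_div, inv_pow, ← div_eq_inv_mul, le_div_iff₀ (by positivity)]
    simpa using hP
  nlinarith

/-- The infinite convolutions defining the tails converge weakly, so that `tail` is not a
default value. -/
theorem tendsto_tail (D : CantorMoranData) (n : ℕ) :
    Tendsto (finConv fun j => D.factor (n + j)) atTop (𝓝 (D.tail n)) :=
  tendsto_infConv _ (fun j => (1 / 2 : ℝ) ^ (n + j))
    ((summable_geometric_two.mul_left ((1 / 2 : ℝ) ^ n)).congr fun _ => (pow_add _ _ _).symm)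
    fun j => D.ae_factor_norm_le (n + j)

end CantorMoranData

/-- The Fourier transform `μ̂(ξ) = ∫ e^{-2πiξx} dμ(x)` of a Borel probability measure on `ℝ`. -/
def fourierTransform (μ : ProbabilityMeasure ℝ) (ξ : ℝ) : ℂ :=
  ∫ x : ℝ, Complex.exp (-2 * Real.pi * Complex.I * ξ * x) ∂(μ : Measure ℝ)

/-- A collection of probability measures is equi-positive if for some `ε > 0`, all `x ∈ [0, 1]` and
all its members `ν` there is `k ∈ ℤ` with `|ν̂(x + k)| ≥ ε`. -/
def IsEquiPositive (Φ : Set (ProbabilityMeasure ℝ)) : Prop :=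
  ∃ ε : ℝ, 0 < ε ∧ ∀ x ∈ Set.Icc (0 : ℝ) 1, ∀ ν ∈ Φ, ∃ k : ℤ, ε ≤ ‖fourierTransform ν (x + k)‖

/-- The measure `ρ = (δ_0 + δ_1) / 2`. -/
def rhoMeasure : ProbabilityMeasure ℝ :=
  ⟨uniformDirac {0, 1}, isProbabilityMeasure_uniformDirac (Finset.insert_nonempty _ _)⟩

end

/-! One example serves both parts. Since `ρ̂` vanishes on `1/2 + ℤ`, uniform convergence there rules
out equi-positivity of every subsequence at `x = 1/2`. Each digit set is symmetric, `{0} ∪ C ∪ (N -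
C)`, with `max C / N → 0`: about half of the mass lies near `0` and half near `1`, which gives the
weak limit `ρ`. On `1/2 + ℤ`, `exp (it) = -1`, so the terms of `c` and `N - c` combine to `2i sin
(ct/N)`. It remains to find `C` with `∑ c ∈ C, sin (cφ) = o(#C)` uniformly in `φ`. The odd numbers
below `2M` fail only for `sin φ` of size about `1/M`: their sine sum is `sin² (Mφ) / sin φ`, at most
`min (M² |sin φ|) (1 / |sin φ|)`. Taking their multiples by `2 ^ j`, `j < J`, replaces `φ` by `2 ^ j
φ`, and while `|sin|` grows geometrically these bounds sum to `O(M)`, against `#C = JM`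
(`abs_sum_sin_dyadicOdd_le`). -/

/-! ### Characteristic functions, convolutions and supports. -/

theorem fourierTransform_eq_charFun (μ : ProbabilityMeasure ℝ) (ξ : ℝ) :
    fourierTransform μ ξ = charFun (μ : Measure ℝ) (-2 * Real.pi * ξ) := by
  rw [charFun_apply_real, fourierTransform]
  refine integral_congr_ae (.of_forall fun x => ?_)
  simp only
  congr 1
  push_cast
  ring

theorem charFun_uniformDirac (A : Finset ℝ) (t : ℝ) :
    charFun (uniformDirac A) t = (A.card : ℂ)⁻¹ * ∑ a ∈ A, Complex.exp (t * a * Complex.I) := by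
  rw [charFun_apply_real, uniformDirac, integral_smul_measure,
    integral_finsetSum_measure fun a _ => by exact integrable_dirac (by simp)]
  simp

theorem norm_charFun_sub_one_le {μ : Measure ℝ} [IsProbabilityMeasure μ] {R : ℝ}
    (hμ : ∀ᵐ x ∂μ, ‖x‖ ≤ R) (t : ℝ) : ‖charFun μ t - 1‖ ≤ R * |t| := by
  have h1 : charFun μ t - 1 = ∫ x, (Complex.exp (t * x * Complex.I) - 1) ∂μ := by
    rw [integral_sub _ (integrable_const _), charFun_apply_real]
    · simp
    · refine Integrable.of_bound (by fun_prop) 1 (.of_forall fun x => ?_)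
      rw [← Complex.ofReal_mul, Complex.norm_exp_ofReal_mul_I]
  rw [h1]
  refine (norm_integral_le_of_norm_le_const (C := R * |t|) ?_).trans (by simp)
  filter_upwards [hμ] with x hx
  have := Real.norm_exp_I_mul_ofReal_sub_one_le (x := t * x)
  rw [mul_comm, Complex.ofReal_mul] at this
  refine this.trans ?_
  rw [norm_mul, mul_comm, Real.norm_eq_abs t]
  gcongr

theorem charFun_finConv (μ : ℕ → ProbabilityMeasure ℝ) (n : ℕ) (t : ℝ) :
    charFun (finConv μ n : Measure ℝ) t =
      ∏ j ∈ Finset.range n, charFun (μ j : Measure ℝ) t := by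
  induction n with
  | zero => simp [finConv]
  | succ n ih =>
    rw [Finset.prod_range_succ, ← ih, ← charFun_conv]
    rfl

theorem ae_conv_mem_Icc {μ ν : Measure ℝ} [SFinite μ] [SFinite ν] {a b : ℝ}
    (hμ : ∀ᵐ x ∂μ, x ∈ Set.Icc 0 a) (hν : ∀ᵐ x ∂ν, x ∈ Set.Icc 0 b) :
    ∀ᵐ x ∂(μ.conv ν), x ∈ Set.Icc 0 (a + b) := by
  rw [Measure.conv]
  refine (ae_map_iff (by fun_prop) measurableSet_Icc).2 ?_
  filter_upwards [Measure.quasiMeasurePreserving_fst.ae hμ,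
    Measure.quasiMeasurePreserving_snd.ae hν] with x h1 h2
  exact ⟨add_nonneg h1.1 h2.1, add_le_add h1.2 h2.2⟩

theorem ae_mem_of_tendsto_of_isClosed {μ : ℕ → ProbabilityMeasure ℝ} {ν : ProbabilityMeasure ℝ}
    (h : Tendsto μ atTop (𝓝 ν)) {F : Set ℝ} (hF : IsClosed F)
    (hμ : ∀ n, ∀ᵐ x ∂(μ n : Measure ℝ), x ∈ F) : ∀ᵐ x ∂(ν : Measure ℝ), x ∈ F := by
  have := ProbabilityMeasure.le_liminf_measure_open_of_tendsto h hF.isOpen_compl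
  have h0 : ∀ n, (μ n : Measure ℝ) Fᶜ = 0 := fun n => mem_ae_iff.1 (hμ n)
  simp only [h0, liminf_const, nonpos_iff_eq_zero] at this
  exact mem_ae_iff.2 this

/-! ### Tails of Cantor–Moran measures: self-similarity and support. -/

namespace CantorMoranData

theorem prodN_pos (D : CantorMoranData) (n : ℕ) : (0 : ℝ) < D.prodN n := by
  exact_mod_cast (Nat.two_pow_pos n).trans_le (D.two_pow_le_prodN n)

theorem N_pos (D : CantorMoranData) (n : ℕ) : (0 : ℝ) < D.N n := by
  exact_mod_cast two_pos.trans_le (D.two_le n)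

theorem prodN_succ (D : CantorMoranData) (n : ℕ) :
    (D.prodN (n + 1) : ℝ) = D.prodN n * D.N n := by
  simp [prodN, Finset.prod_range_succ]

theorem charFun_factor (D : CantorMoranData) (n : ℕ) (t : ℝ) :
    charFun (D.factor n : Measure ℝ) t =
      ((D.B n).card : ℂ)⁻¹ *
        ∑ b ∈ D.B n, Complex.exp (t * (b / D.prodN (n + 1)) * Complex.I) := by
  have hinj : Function.Injective fun b : ℕ => (b : ℝ) / (D.prodN (n + 1) : ℝ) := fun a b h => by
    have := (div_left_inj' (D.prodN_pos (n + 1)).ne').1 h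
    exact_mod_cast this
  rw [factor, ProbabilityMeasure.coe_mk, charFun_uniformDirac, scaledDigits,
    Finset.card_image_of_injective _ hinj, Finset.sum_image hinj.injOn]
  simp

theorem tendsto_charFun_tail (D : CantorMoranData) (n : ℕ) (t : ℝ) :
    Tendsto (fun k => ∏ j ∈ Finset.range k, charFun (D.factor (n + j) : Measure ℝ) t) atTop
      (𝓝 (charFun (D.tail n : Measure ℝ) t)) := by
  simp_rw [← charFun_finConv (fun j => D.factor (n + j))]
  exact ProbabilityMeasure.tendsto_iff_tendsto_charFun.1 (D.tendsto_tail n) t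

theorem charFun_tail (D : CantorMoranData) (n : ℕ) (t : ℝ) :
    charFun (D.tail n : Measure ℝ) t =
      charFun (D.factor n : Measure ℝ) t * charFun (D.tail (n + 1) : Measure ℝ) t := by
  refine tendsto_nhds_unique ((D.tendsto_charFun_tail n t).comp (tendsto_add_atTop_nat 1)) ?_
  refine ((D.tendsto_charFun_tail (n + 1) t).const_mul _).congr fun k => ?_
  simp only [Function.comp_apply, Finset.prod_range_succ', add_zero]
  rw [mul_comm]
  congr 1
  exact Finset.prod_congr rfl fun j _ => by rw [add_right_comm, add_assoc]

theorem charFun_nu (D : CantorMoranData) (n : ℕ) (t : ℝ) :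
    charFun (D.nu n : Measure ℝ) t = charFun (D.tail n : Measure ℝ) (D.prodN n * t) := by
  rw [nu, ProbabilityMeasure.toMeasure_map, charFun_map_mul]

/-- Splits off the first digit. Only this factor matters later: the other one has norm at most `1`,
and its argument is divided by `N`. -/
theorem charFun_nu_eq_mul (D : CantorMoranData) (n : ℕ) (t : ℝ) :
    charFun (D.nu n : Measure ℝ) t =
      ((D.B n).card : ℂ)⁻¹ * (∑ b ∈ D.B n, Complex.exp (t * (b / D.N n) * Complex.I)) *
        charFun (D.nu (n + 1) : Measure ℝ) (t / D.N n) := by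
  have hP := D.prodN_pos n
  have hN := D.N_pos n
  rw [charFun_nu, charFun_tail, charFun_factor, charFun_nu]
  congr 2
  · refine Finset.sum_congr rfl fun b _ => ?_
    congr 2
    have : (D.prodN n * t) * (b / D.prodN (n + 1) : ℝ) = t * (b / D.N n) := by
      rw [prodN_succ]
      field_simp
    simpa using congrArg Complex.ofReal this
  · rw [prodN_succ]
    field_simp

/-- Digits are at most `N - 1`; in this form the bounds telescope under convolution. -/
theorem ae_factor_mem_Icc (D : CantorMoranData) (n : ℕ) :
    ∀ᵐ x ∂(D.factor n : Measure ℝ),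
      x ∈ Set.Icc (0 : ℝ) ((D.prodN n : ℝ)⁻¹ - (D.prodN (n + 1) : ℝ)⁻¹) := by
  refine ae_uniformDirac fun a ha => ?_
  obtain ⟨b, hb, rfl⟩ := Finset.mem_image.1 ha
  have hb1 : (b : ℝ) + 1 ≤ D.N n := by exact_mod_cast D.digit_lt n b hb
  have hP := D.prodN_pos n
  have hN := D.N_pos n
  refine ⟨by positivity, ?_⟩
  have : (D.prodN n : ℝ)⁻¹ - (D.prodN (n + 1) : ℝ)⁻¹ = (D.N n - 1) / D.prodN (n + 1) := by
    rw [prodN_succ]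
    field_simp
  rw [this]
  gcongr
  linarith

theorem ae_finConv_mem_Icc (D : CantorMoranData) (n k : ℕ) :
    ∀ᵐ x ∂(finConv (fun j => D.factor (n + j)) k : Measure ℝ),
      x ∈ Set.Icc (0 : ℝ) ((D.prodN n : ℝ)⁻¹ - (D.prodN (n + k) : ℝ)⁻¹) := by
  induction k with
  | zero => simp [finConv, ae_dirac_eq]
  | succ k ih =>
    have := ae_conv_mem_Icc ih (D.ae_factor_mem_Icc (n + k))
    rw [sub_add_sub_cancel] at this
    exact this

theorem ae_tail_mem_Icc (D : CantorMoranData) (n : ℕ) :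
    ∀ᵐ x ∂(D.tail n : Measure ℝ), x ∈ Set.Icc (0 : ℝ) (D.prodN n : ℝ)⁻¹ := by
  refine ae_mem_of_tendsto_of_isClosed (D.tendsto_tail n) isClosed_Icc fun k => ?_
  filter_upwards [D.ae_finConv_mem_Icc n k] with x hx
  have := D.prodN_pos (n + k)
  exact ⟨hx.1, hx.2.trans (sub_le_self _ (by positivity))⟩

theorem ae_nu_mem_Icc (D : CantorMoranData) (n : ℕ) :
    ∀ᵐ x ∂(D.nu n : Measure ℝ), x ∈ Set.Icc (0 : ℝ) 1 := by
  have hP := D.prodN_pos n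
  rw [nu, ProbabilityMeasure.toMeasure_map]
  refine (ae_map_iff (by fun_prop) measurableSet_Icc).2 ?_
  filter_upwards [D.ae_tail_mem_Icc n] with x hx
  refine ⟨mul_nonneg hP.le hx.1, ?_⟩
  calc (D.prodN n : ℝ) * x ≤ D.prodN n * (D.prodN n : ℝ)⁻¹ := by gcongr; exact hx.2
    _ = 1 := mul_inv_cancel₀ hP.ne'

theorem norm_charFun_nu_sub_one_le (D : CantorMoranData) (n : ℕ) (t : ℝ) :
    ‖charFun (D.nu n : Measure ℝ) t - 1‖ ≤ |t| := by
  simpa using norm_charFun_sub_one_le (R := 1)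
    ((D.ae_nu_mem_Icc n).mono fun x hx => by rw [Real.norm_of_nonneg hx.1]; exact hx.2) t

end CantorMoranData

/-! ### Sine sums over dyadic multiples of odd numbers. -/

theorem sum_sin_odd_mul_sin (M : ℕ) (φ : ℝ) :
    (∑ m ∈ Finset.range M, Real.sin ((2 * m + 1) * φ)) * Real.sin φ = Real.sin (M * φ) ^ 2 := by
  induction M with
  | zero => simp
  | succ M ih =>
    rw [Finset.sum_range_succ, add_mul, ih, Nat.cast_succ,
      show (2 * (M : ℝ) + 1) * φ = 2 * (M * φ) + φ by ring,
      show ((M : ℝ) + 1) * φ = M * φ + φ by ring, Real.sin_add, Real.sin_add,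
      Real.sin_two_mul, Real.cos_two_mul]
    have h1 := Real.sin_sq_add_cos_sq (M * φ)
    have h2 := Real.sin_sq_add_cos_sq φ
    linear_combination (Real.sin φ) ^ 2 * h1 - Real.sin (M * φ) ^ 2 * h2

theorem abs_sin_nat_mul_le (M : ℕ) (φ : ℝ) : |Real.sin (M * φ)| ≤ M * |Real.sin φ| := by
  induction M with
  | zero => simp
  | succ M ih =>
    rw [Nat.cast_succ, add_mul, one_mul, Real.sin_add, add_mul, one_mul]
    refine (abs_add_le _ _).trans (add_le_add ?_ ?_) <;> rw [abs_mul]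
    · exact (mul_le_of_le_one_right (abs_nonneg _) (Real.abs_cos_le_one _)).trans ih
    · exact mul_le_of_le_one_left (abs_nonneg _) (Real.abs_cos_le_one _)

theorem abs_sum_sin_odd_mul_abs_sin_le (M : ℕ) (φ : ℝ) :
    |∑ m ∈ Finset.range M, Real.sin ((2 * m + 1) * φ)| * |Real.sin φ| ≤ 1 := by
  rw [← abs_mul, sum_sin_odd_mul_sin, abs_of_nonneg (sq_nonneg _)]
  exact Real.sin_sq_le_one _

theorem abs_sum_sin_odd_le (M : ℕ) (φ : ℝ) :
    |∑ m ∈ Finset.range M, Real.sin ((2 * m + 1) * φ)| ≤ M ^ 2 * |Real.sin φ| := by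
  rcases eq_or_ne (Real.sin φ) 0 with h | h
  · have : ∀ m ∈ Finset.range M, Real.sin ((2 * m + 1) * φ) = 0 := fun m _ => by
      have := abs_sin_nat_mul_le (2 * m + 1) φ
      rw [h, abs_zero, mul_zero] at this
      exact_mod_cast abs_nonpos_iff.1 this
    simp [Finset.sum_eq_zero this, h]
  · refine le_of_mul_le_mul_right ?_ (abs_pos.2 h)
    rw [← abs_mul, sum_sin_odd_mul_sin, abs_of_nonneg (sq_nonneg _), ← sq_abs]
    calc |Real.sin (M * φ)| ^ 2 ≤ (M * |Real.sin φ|) ^ 2 := by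
          gcongr; exact abs_sin_nat_mul_le M φ
      _ = _ := by ring

/-- The bounded potential `12u / (1 + u)` turns a sum of `min u (1/u)` along a geometrically growing
`u` into a telescoping one. Both sides are compared with `4u / (1 + u)²`; `12` is what the ratio
`3/2` requires for large `u`. -/
theorem le_div_one_add_sub_div_one_add {x u v : ℝ} (hu : 0 ≤ u) (huv : 3 / 2 * u ≤ v)
    (hxu : x ≤ u) (hx : x * u ≤ 1) : x ≤ 12 * (v / (1 + v)) - 12 * (u / (1 + u)) := by
  have h1 : 3 / 2 * u / (1 + 3 / 2 * u) ≤ v / (1 + v) := by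
    rw [div_le_div_iff₀ (by positivity) (by linarith)]
    nlinarith
  have h2 : x * (1 + u) ^ 2 ≤ 4 * u := by
    rcases le_total x 0 with h | h
    · nlinarith [mul_nonneg (neg_nonneg.2 h) (sq_nonneg (1 + u))]
    · nlinarith [mul_nonneg hu (sub_nonneg.2 hx)]
  have h3 : 4 * u / (1 + u) ^ 2 ≤
      12 * (3 / 2 * u / (1 + 3 / 2 * u)) - 12 * (u / (1 + u)) := by
    have : 12 * (3 / 2 * u / (1 + 3 / 2 * u)) - 12 * (u / (1 + u)) =
        6 * u / ((1 + u) * (1 + 3 / 2 * u)) := by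
      field_simp
      ring
    rw [this, div_le_div_iff₀ (by positivity) (by positivity)]
    nlinarith [mul_nonneg hu hu, mul_nonneg (mul_nonneg hu hu) hu,
      mul_nonneg (mul_nonneg (mul_nonneg hu hu) hu) hu]
  have h4 : x ≤ 4 * u / (1 + u) ^ 2 := by rwa [le_div_iff₀ (by positivity)]
  linarith

theorem three_halves_mul_abs_sin_le {φ : ℝ} (h : |Real.sin φ| ≤ 1 / 2) :
    3 / 2 * |Real.sin φ| ≤ |Real.sin (2 * φ)| := by
  rw [Real.sin_two_mul, abs_mul, abs_mul, abs_two]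
  have h1 : 3 / 4 ≤ |Real.cos φ| := by
    refine abs_le_of_sq_le_sq' ?_ (abs_nonneg _) |>.2
    have := Real.sin_sq_add_cos_sq φ
    rw [← sq_abs (Real.sin φ), ← sq_abs (Real.cos φ)] at this
    nlinarith [abs_nonneg (Real.sin φ)]
  nlinarith [abs_nonneg (Real.sin φ)]

theorem abs_sin_two_mul_le (φ : ℝ) : |Real.sin (2 * φ)| ≤ 2 * |Real.sin φ| := by
  exact_mod_cast abs_sin_nat_mul_le 2 φ

/-- The hypothesis keeps `|sin (2 ^ j φ)| ≤ 1/2` for `j < J`, so every doubling enlarges `|sin|` by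
at least `3/2` and the potential telescopes with `u = M |sin φ|`. -/
theorem sum_abs_sum_sin_le_of_abs_sin_le (M J : ℕ) (φ : ℝ) (h : |Real.sin φ| ≤ (1 / 2) ^ J) :
    ∑ j ∈ Finset.range J, |∑ m ∈ Finset.range M, Real.sin ((2 * m + 1) * (2 ^ j * φ))| ≤
      12 * M - 12 * M * (M * |Real.sin φ| / (1 + M * |Real.sin φ|)) := by
  induction J generalizing φ with
  | zero =>
    have : M * |Real.sin φ| / (1 + M * |Real.sin φ|) ≤ 1 :=
      div_le_one_of_le₀ (by linarith) (by positivity)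
    simp only [Finset.range_zero, Finset.sum_empty]
    nlinarith [Nat.cast_nonneg (α := ℝ) M]
  | succ J ih =>
    have hJ : ((1 : ℝ) / 2) ^ J ≤ 1 := pow_le_one₀ (by norm_num) (by norm_num)
    rw [pow_succ] at h
    have h2 := ih (2 * φ) ((abs_sin_two_mul_le φ).trans (by linarith))
    rw [Finset.sum_range_succ']
    have h3 : ∀ j : ℕ, (2 : ℝ) ^ (j + 1) * φ = 2 ^ j * (2 * φ) := fun j => by ring
    simp only [h3, pow_zero, one_mul]
    rcases Nat.eq_zero_or_pos M with rfl | hM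
    · simp
    have hM' : (0 : ℝ) < M := by exact_mod_cast hM
    set S := |∑ m ∈ Finset.range M, Real.sin ((2 * m + 1) * φ)|
    have h4 := le_div_one_add_sub_div_one_add (x := S / M) (u := M * |Real.sin φ|)
      (v := M * |Real.sin (2 * φ)|) (by positivity)
      (by nlinarith [three_halves_mul_abs_sin_le (φ := φ) (by linarith)])
      (by rw [div_le_iff₀ hM']; linarith [abs_sum_sin_odd_le M φ])
      (by rw [← mul_assoc, div_mul_cancel₀ _ hM'.ne']; exact abs_sum_sin_odd_mul_abs_sin_le M φ)
    rw [div_le_iff₀ hM'] at h4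
    linarith

/-- Scales with a large sine are peeled off at cost `2 ^ K` each, until the telescoping bound covers
all the rest. `K` stays fixed while `J` drops. -/
theorem sum_abs_sum_sin_le_aux (M K J : ℕ) (hJK : J ≤ K) (φ : ℝ) :
    ∑ j ∈ Finset.range J, |∑ m ∈ Finset.range M, Real.sin ((2 * m + 1) * (2 ^ j * φ))| ≤
      12 * M + J * 2 ^ K := by
  induction J generalizing φ with
  | zero => simp
  | succ J ih =>
    rcases le_or_gt |Real.sin φ| ((1 / 2) ^ (J + 1)) with h | h
    · refine (sum_abs_sum_sin_le_of_abs_sin_le M (J + 1) φ h).trans ?_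
      have : 0 ≤ 12 * M * (M * |Real.sin φ| / (1 + M * |Real.sin φ|)) := by positivity
      have : (0 : ℝ) ≤ (J + 1 : ℕ) * 2 ^ K := by positivity
      linarith
    · rw [Finset.sum_range_succ']
      have h3 : ∀ j : ℕ, (2 : ℝ) ^ (j + 1) * φ = 2 ^ j * (2 * φ) := fun j => by ring
      simp only [h3, pow_zero, one_mul]
      have h1 := ih (by omega) (2 * φ)
      have h2 : |∑ m ∈ Finset.range M, Real.sin ((2 * m + 1) * φ)| ≤ 2 ^ K := by
        have h5 : ((1 : ℝ) / 2) ^ K ≤ |Real.sin φ| :=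
          (pow_le_pow_of_le_one (by norm_num) (by norm_num) hJK).trans h.le
        have h6 := abs_sum_sin_odd_mul_abs_sin_le M φ
        have h7 := (mul_le_mul_of_nonneg_left h5
          (abs_nonneg (∑ m ∈ Finset.range M, Real.sin ((2 * m + 1) * φ)))).trans h6
        rwa [one_div, inv_pow, ← div_eq_mul_inv, div_le_one₀ (by positivity)] at h7
      push_cast
      linarith

theorem sum_abs_sum_sin_le (M J : ℕ) (φ : ℝ) :
    ∑ j ∈ Finset.range J, |∑ m ∈ Finset.range M, Real.sin ((2 * m + 1) * (2 ^ j * φ))| ≤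
      12 * M + J * 2 ^ J :=
  sum_abs_sum_sin_le_aux M J J le_rfl φ

/-! ### The digits `2 ^ j * (2 * m + 1)`. -/

/-- The positive integers `2 ^ j * (2 * m + 1)` with `j < J` and `m < M`. -/
def dyadicOdd (J M : ℕ) : Finset ℕ :=
  (Finset.range J ×ˢ Finset.range M).image fun p => 2 ^ p.1 * (2 * p.2 + 1)

theorem injective_two_pow_mul_odd :
    Function.Injective fun p : ℕ × ℕ => 2 ^ p.1 * (2 * p.2 + 1) := by
  have key : ∀ {a b c d : ℕ}, a ≤ c → 2 ^ a * (2 * b + 1) = 2 ^ c * (2 * d + 1) →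
      a = c ∧ b = d := by
    intro a b c d hac h
    obtain ⟨k, rfl⟩ := Nat.exists_eq_add_of_le hac
    rw [pow_add, mul_assoc] at h
    have h := Nat.eq_of_mul_eq_mul_left (Nat.two_pow_pos a) h
    rcases k with - | k
    · simp at h
      exact ⟨rfl, h⟩
    · rw [pow_succ, mul_comm _ 2, mul_assoc] at h
      omega
  rintro ⟨a, b⟩ ⟨c, d⟩ h
  rcases le_total a c with hac | hac
  · obtain ⟨rfl, rfl⟩ := key hac h
    rfl
  · obtain ⟨rfl, rfl⟩ := key hac h.symm
    rfl

theorem card_dyadicOdd (J M : ℕ) : (dyadicOdd J M).card = J * M := by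
  rw [dyadicOdd, Finset.card_image_of_injective _ injective_two_pow_mul_odd,
    Finset.card_product, Finset.card_range, Finset.card_range]

theorem pos_and_lt_of_mem_dyadicOdd {J M c : ℕ} (hc : c ∈ dyadicOdd J M) :
    0 < c ∧ c < 2 ^ J * M := by
  obtain ⟨⟨j, m⟩, h, rfl⟩ := Finset.mem_image.1 hc
  simp only [Finset.mem_product, Finset.mem_range] at h
  refine ⟨by positivity, ?_⟩
  calc 2 ^ j * (2 * m + 1) < 2 ^ j * (2 * M) := by gcongr; omega
    _ = 2 ^ (j + 1) * M := by ring
    _ ≤ 2 ^ J * M := by gcongr <;> omega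

theorem abs_sum_sin_dyadicOdd_le (J M : ℕ) (φ : ℝ) :
    |∑ c ∈ dyadicOdd J M, Real.sin (c * φ)| ≤ 12 * M + J * 2 ^ J := by
  rw [dyadicOdd, Finset.sum_image injective_two_pow_mul_odd.injOn, Finset.sum_product]
  refine (Finset.abs_sum_le_sum_abs _ _).trans (le_trans (le_of_eq ?_) (sum_abs_sum_sin_le M J φ))
  refine Finset.sum_congr rfl fun j _ => ?_
  congr 1
  refine Finset.sum_congr rfl fun m _ => ?_
  congr 1
  push_cast
  ring

/-! ### Exponential sums over symmetric digit sets. -/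

/-- The digit set `{0} ∪ C ∪ (N - C)`. -/
def reflectedDigits (N : ℕ) (C : Finset ℕ) : Finset ℕ :=
  insert 0 (C ∪ C.image fun c => N - c)

section reflectedDigits

variable {N : ℕ} {C : Finset ℕ}

theorem sum_reflectedDigits {R : Type*} [AddCommMonoid R] (hC : ∀ c ∈ C, 0 < c ∧ 2 * c < N)
    (f : ℕ → R) :
    ∑ b ∈ reflectedDigits N C, f b = f 0 + ∑ c ∈ C, (f c + f (N - c)) := by
  rw [reflectedDigits, Finset.sum_insert, Finset.sum_union, Finset.sum_image,
    Finset.sum_add_distrib]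
  · intro a ha b hb h
    have h1 := hC a ha
    have h2 := hC b hb
    simp only at h
    omega
  · refine Finset.disjoint_left.2 fun a ha h => ?_
    obtain ⟨b, hb, rfl⟩ := Finset.mem_image.1 h
    have h1 := hC _ ha
    have h2 := hC b hb
    omega
  · intro h
    rcases Finset.mem_union.1 h with h | h
    · exact (hC 0 h).1.ne rfl
    · obtain ⟨b, hb, h⟩ := Finset.mem_image.1 h
      have h2 := hC b hb
      omega

theorem card_reflectedDigits (hC : ∀ c ∈ C, 0 < c ∧ 2 * c < N) :
    (reflectedDigits N C).card = 1 + 2 * C.card := by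
  rw [Finset.card_eq_sum_ones, sum_reflectedDigits hC]
  simp [mul_comm]

theorem lt_of_mem_reflectedDigits (hN : 0 < N) (hC : ∀ c ∈ C, 0 < c ∧ 2 * c < N) {b : ℕ}
    (hb : b ∈ reflectedDigits N C) : b < N := by
  simp only [reflectedDigits, Finset.mem_insert, Finset.mem_union, Finset.mem_image] at hb
  rcases hb with rfl | h | ⟨c, h, rfl⟩
  · exact hN
  · have := hC b h
    omega
  · have := hC c h
    omega

theorem sum_exp_reflectedDigits (hN : 0 < N) (hC : ∀ c ∈ C, 0 < c ∧ 2 * c < N) (t : ℝ) :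
    ∑ b ∈ reflectedDigits N C, Complex.exp (t * (b / N) * Complex.I) =
      1 + ∑ c ∈ C, (Complex.exp ((c * (t / N) : ℝ) * Complex.I) +
        Complex.exp (t * Complex.I) * Complex.exp (-(c * (t / N) : ℝ) * Complex.I)) := by
  have hN' : (N : ℂ) ≠ 0 := by exact_mod_cast hN.ne'
  rw [sum_reflectedDigits hC]
  simp only [Nat.cast_zero, zero_div, mul_zero, zero_mul, Complex.exp_zero]
  congr 1
  refine Finset.sum_congr rfl fun c hc => ?_
  have h1 := hC c hc
  rw [← Complex.exp_add, Nat.cast_sub (by omega)]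
  congr 2
  · push_cast
    ring
  · push_cast
    field_simp
    ring

theorem norm_sum_exp_reflectedDigits_le (hN : 0 < N) (hC : ∀ c ∈ C, 0 < c ∧ 2 * c < N) {t : ℝ}
    (ht : Complex.exp (t * Complex.I) = -1) :
    ‖∑ b ∈ reflectedDigits N C, Complex.exp (t * (b / N) * Complex.I)‖ ≤
      1 + 2 * |∑ c ∈ C, Real.sin (c * (t / N))| := by
  rw [sum_exp_reflectedDigits hN hC, ht]
  have : ∀ x : ℝ, Complex.exp (x * Complex.I) + -1 * Complex.exp (-x * Complex.I) =
      2 * Complex.I * (Real.sin x : ℝ) := fun x => by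
    rw [Complex.exp_mul_I, Complex.exp_mul_I, Complex.cos_neg, Complex.sin_neg,
      Complex.ofReal_sin]
    ring
  simp only [this]
  rw [← Finset.mul_sum, ← Complex.ofReal_sum]
  refine (norm_add_le _ _).trans (le_of_eq ?_)
  rw [norm_mul, Complex.norm_real, Real.norm_eq_abs]
  simp only [norm_one, norm_mul, Complex.norm_ofNat, Complex.norm_I, mul_one]

/-- Each pair `c`, `N - c` contributes `1 + exp (it)` up to `2r|t|`; the digit `0`, which has no
partner, accounts for the extra `1`. -/
theorem norm_mean_exp_reflectedDigits_sub_le (hN : 0 < N)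
    (hC : ∀ c ∈ C, 0 < c ∧ 2 * c < N) {r : ℝ} (hr : ∀ c ∈ C, (c : ℝ) / N ≤ r) (t : ℝ) :
    ‖((reflectedDigits N C).card : ℂ)⁻¹ *
        (∑ b ∈ reflectedDigits N C, Complex.exp (t * (b / N) * Complex.I)) -
      (1 + Complex.exp (t * Complex.I)) / 2‖ ≤
      (1 + 2 * C.card * (r * |t|)) / (1 + 2 * C.card) := by
  have hK : (0 : ℝ) < 1 + 2 * C.card := by positivity
  have hK' : (1 + 2 * C.card : ℂ) ≠ 0 := by exact_mod_cast hK.ne'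
  rw [sum_exp_reflectedDigits hN hC, card_reflectedDigits hC]
  set e := Complex.exp (t * Complex.I)
  have hne : ‖e‖ = 1 := Complex.norm_exp_ofReal_mul_I t
  have h1 : ((1 + 2 * C.card : ℕ) : ℂ)⁻¹ *
      (1 + ∑ c ∈ C, (Complex.exp ((c * (t / N) : ℝ) * Complex.I) +
        e * Complex.exp (-(c * (t / N) : ℝ) * Complex.I))) - (1 + e) / 2 =
      ((1 - e) / 2 + ∑ c ∈ C, ((Complex.exp ((c * (t / N) : ℝ) * Complex.I) - 1) +
        e * (Complex.exp (-(c * (t / N) : ℝ) * Complex.I) - 1))) / (1 + 2 * C.card) := by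
    have : ∀ c : ℕ, (Complex.exp ((c * (t / N) : ℝ) * Complex.I) - 1) +
        e * (Complex.exp (-(c * (t / N) : ℝ) * Complex.I) - 1) =
        (Complex.exp ((c * (t / N) : ℝ) * Complex.I) +
        e * Complex.exp (-(c * (t / N) : ℝ) * Complex.I)) - (1 + e) := fun c => by ring
    simp only [this, Finset.sum_sub_distrib, Finset.sum_const, nsmul_eq_mul]
    generalize ∑ c ∈ C, (Complex.exp ((c * (t / N) : ℝ) * Complex.I) +
      e * Complex.exp (-(c * (t / N) : ℝ) * Complex.I)) = S
    push_cast
    field_simp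
    ring
  have h2 : ‖(1 + 2 * C.card : ℂ)‖ = 1 + 2 * C.card := by
    exact_mod_cast Complex.norm_of_nonneg hK.le
  rw [h1, norm_div, h2]
  gcongr
  refine (norm_add_le _ _).trans (add_le_add ?_ ?_)
  · rw [norm_div, Complex.norm_ofNat, div_le_one (by norm_num)]
    refine (norm_sub_le _ _).trans ?_
    rw [hne, norm_one]
    norm_num
  · refine (norm_sum_le_of_le C (f := fun _ => _) (n := fun _ => 2 * (r * |t|))
      fun c hc => ?_).trans (le_of_eq (by simp; ring))
    have h4 : ∀ x : ℝ, ‖Complex.exp (x * Complex.I) - 1‖ ≤ |x| := fun x => by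
      simpa [mul_comm] using Real.norm_exp_I_mul_ofReal_sub_one_le (x := x)
    have h3 : |(c : ℝ) * (t / N)| ≤ r * |t| := by
      rw [← mul_div_assoc, mul_div_right_comm, abs_mul, abs_of_nonneg (by positivity)]
      gcongr
      exact hr c hc
    refine (norm_add_le _ _).trans ?_
    rw [norm_mul, hne, one_mul, two_mul]
    have h5 := h4 (-(c * (t / N)))
    rw [abs_neg, Complex.ofReal_neg] at h5
    exact add_le_add ((h4 _).trans h3) (h5.trans h3)

end reflectedDigits

/-! ### The limit `ρ` and the failure of equi-positivity. -/

theorem charFun_rhoMeasure (t : ℝ) :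
    charFun (rhoMeasure : Measure ℝ) t = (1 + Complex.exp (t * Complex.I)) / 2 := by
  rw [rhoMeasure, ProbabilityMeasure.coe_mk, charFun_uniformDirac,
    Finset.sum_pair zero_ne_one, Finset.card_pair zero_ne_one]
  simp [div_eq_inv_mul]

theorem exp_neg_two_pi_mul_half_add_int (k : ℤ) :
    Complex.exp ((-2 * Real.pi * (1 / 2 + k) : ℝ) * Complex.I) = -1 := by
  have : ((-2 * Real.pi * (1 / 2 + k) : ℝ) : ℂ) * Complex.I =
      -(Real.pi * Complex.I) - k * (2 * Real.pi * Complex.I) := by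
    push_cast
    ring
  rw [this, Complex.exp_periodic.sub_int_mul_eq, Complex.exp_neg, Complex.exp_pi_mul_I]
  norm_num

theorem fourierTransform_rhoMeasure_half_add_int (k : ℤ) :
    fourierTransform rhoMeasure (1 / 2 + k) = 0 := by
  rw [fourierTransform_eq_charFun, charFun_rhoMeasure, exp_neg_two_pi_mul_half_add_int]
  simp

theorem not_isEquiPositive_of_tendstoUniformlyOn {ν : ℕ → ProbabilityMeasure ℝ}
    (h : TendstoUniformlyOn (fun n => fourierTransform (ν n)) (fourierTransform rhoMeasure) atTop
      {ξ : ℝ | ∃ k : ℤ, ξ = 1 / 2 + k}) :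
    ¬ ∃ φ : ℕ → ℕ, StrictMono φ ∧ IsEquiPositive (Set.range fun k => ν (φ k)) := by
  rintro ⟨φ, hφ, ε, hε, H⟩
  obtain ⟨n, hn⟩ := (hφ.tendsto_atTop.eventually
    (Metric.tendstoUniformlyOn_iff.1 h ε hε)).exists
  obtain ⟨k, hk⟩ := H (1 / 2) (by norm_num) _ ⟨n, rfl⟩
  have := hn (1 / 2 + k) ⟨k, rfl⟩
  rw [fourierTransform_rhoMeasure_half_add_int, dist_zero_left] at this
  exact absurd hk this.not_ge

/-! ### The example. -/

theorem two_mul_lt_of_mem_dyadicOdd {n c : ℕ} (hc : c ∈ dyadicOdd (n + 1) (4 ^ (n + 1))) :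
    0 < c ∧ 2 * c < 16 ^ (n + 1) := by
  obtain ⟨h1, h2⟩ := pos_and_lt_of_mem_dyadicOdd hc
  refine ⟨h1, ?_⟩
  calc 2 * c < 2 * (2 ^ (n + 1) * 4 ^ (n + 1)) := by gcongr
    _ ≤ 2 ^ (n + 1) * (2 ^ (n + 1) * 4 ^ (n + 1)) := by
      gcongr
      exact Nat.le_self_pow n.succ_ne_zero 2
    _ = 16 ^ (n + 1) := by
      rw [← mul_pow, ← mul_pow]
      norm_num

/-- The data `N = 16 ^ J` and `B = {0} ∪ C ∪ (N - C)`, with `C` the set of all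
`2 ^ j * (2 * m + 1)`, `j < J`, `m < 4 ^ J`, at the levels `J = 1, 2, …`. -/
def dyadicOddData : CantorMoranData where
  N n := 16 ^ (n + 1)
  B n := reflectedDigits (16 ^ (n + 1)) (dyadicOdd (n + 1) (4 ^ (n + 1)))
  two_le n := (by norm_num : 2 ≤ 16).trans (Nat.le_self_pow n.succ_ne_zero 16)
  digit_lt _ _ hb := lt_of_mem_reflectedDigits (by positivity)
    (fun _ => two_mul_lt_of_mem_dyadicOdd) hb
  zero_mem _ := Finset.mem_insert_self _ _

theorem norm_charFun_nu_dyadicOddData_le (n : ℕ) {t : ℝ}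
    (ht : Complex.exp (t * Complex.I) = -1) :
    ‖charFun (dyadicOddData.nu n : Measure ℝ) t‖ ≤ 14 / (n + 1) := by
  rw [CantorMoranData.charFun_nu_eq_mul, norm_mul, norm_mul, norm_inv]
  have hC : ∀ c ∈ dyadicOdd (n + 1) (4 ^ (n + 1)), 0 < c ∧ 2 * c < 16 ^ (n + 1) :=
    fun c => two_mul_lt_of_mem_dyadicOdd
  have hcard : ‖((dyadicOddData.B n).card : ℂ)‖ = 1 + 2 * ((n + 1) * 4 ^ (n + 1)) := by
    rw [Complex.norm_natCast]
    simp only [dyadicOddData]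
    rw [card_reflectedDigits hC, card_dyadicOdd]
    push_cast
    ring
  have hsum := norm_sum_exp_reflectedDigits_le (by positivity) hC ht
  have hsin := abs_sum_sin_dyadicOdd_le (n + 1) (4 ^ (n + 1)) (t / (16 ^ (n + 1) : ℕ))
  -- The choice `M = 4 ^ J` absorbs the error `J * 2 ^ J` into `M`.
  have hpow : ((n + 1 : ℕ) : ℝ) * 2 ^ (n + 1) ≤ 4 ^ (n + 1) := by
    have : ((n + 1 : ℕ) : ℝ) ≤ 2 ^ (n + 1) := by exact_mod_cast Nat.lt_two_pow_self.le
    calc ((n + 1 : ℕ) : ℝ) * 2 ^ (n + 1) ≤ 2 ^ (n + 1) * 2 ^ (n + 1) := by gcongr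
      _ = 4 ^ (n + 1) := by rw [← mul_pow]; norm_num
  have h1 : (1 : ℝ) ≤ 4 ^ (n + 1) := one_le_pow₀ (by norm_num)
  rw [hcard]
  refine (mul_le_of_le_one_right (by positivity) (norm_charFun_le_one _)).trans ?_
  rw [← div_eq_inv_mul, div_le_div_iff₀ (by positivity) (by positivity)]
  -- Here `26 = 2 * (12 + 1)`; dividing by about `2 * J * 4 ^ J` leaves `13 / J`, and `14` absorbs
  -- the digit `0`.
  have h2 : ‖∑ b ∈ dyadicOddData.B n, Complex.exp (t * (b / dyadicOddData.N n) * Complex.I)‖ ≤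
      1 + 26 * 4 ^ (n + 1) := by
    refine hsum.trans ?_
    push_cast at hsin hpow ⊢
    linarith
  have hn : (0 : ℝ) ≤ n := n.cast_nonneg
  nlinarith [mul_le_mul_of_nonneg_right h2 (by positivity : (0 : ℝ) ≤ n + 1),
    mul_nonneg hn (sub_nonneg.2 h1)]

theorem tendsto_nu_dyadicOddData : Tendsto dyadicOddData.nu atTop (𝓝 rhoMeasure) := by
  refine ProbabilityMeasure.tendsto_iff_tendsto_charFun.2 fun t => ?_
  have hlim : ∀ a : ℝ, Tendsto (fun n : ℕ => a * (1 / ((n : ℝ) + 1))) atTop (𝓝 0) := fun a => by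
    simpa using tendsto_one_div_add_atTop_nhds_zero_nat.const_mul a
  have hn2 : ∀ n : ℕ, (n : ℝ) + 1 ≤ 2 ^ (n + 1) := fun n => by
    exact_mod_cast (Nat.lt_two_pow_self (n := n + 1)).le
  have h1 : Tendsto (fun n => charFun (dyadicOddData.nu (n + 1) : Measure ℝ)
      (t / dyadicOddData.N n)) atTop (𝓝 1) := by
    rw [tendsto_iff_norm_sub_tendsto_zero]
    refine squeeze_zero (fun _ => norm_nonneg _) (fun n => ?_) (hlim |t|)
    refine (CantorMoranData.norm_charFun_nu_sub_one_le _ _ _).trans ?_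
    rw [abs_div, Nat.abs_cast, div_eq_mul_one_div]
    simp only [dyadicOddData]
    gcongr
    push_cast
    exact (hn2 n).trans (by gcongr; norm_num)
  have h2 : Tendsto (fun n => ((dyadicOddData.B n).card : ℂ)⁻¹ *
      (∑ b ∈ dyadicOddData.B n, Complex.exp (t * (b / dyadicOddData.N n) * Complex.I))) atTop
      (𝓝 (charFun (rhoMeasure : Measure ℝ) t)) := by
    rw [tendsto_iff_norm_sub_tendsto_zero]
    refine squeeze_zero (fun _ => norm_nonneg _) (fun n => ?_) (hlim (1 + |t|))
    rw [charFun_rhoMeasure]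
    refine (norm_mean_exp_reflectedDigits_sub_le (r := 1 / ((n : ℝ) + 1)) (by positivity)
      (fun _ => two_mul_lt_of_mem_dyadicOdd) (fun c hc => ?_) t).trans ?_
    -- With `N = 16 ^ J`, `c / N ≤ 2 ^ (-J) ≤ 1 / J`.
    · have h3 : (c : ℝ) ≤ 2 ^ (n + 1) * 4 ^ (n + 1) := by
        exact_mod_cast (pos_and_lt_of_mem_dyadicOdd hc).2.le
      rw [div_le_div_iff₀ (by positivity) (by positivity)]
      calc (c : ℝ) * (n + 1) ≤ (2 ^ (n + 1) * 4 ^ (n + 1)) * 2 ^ (n + 1) := by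
            gcongr
            exact hn2 n
        _ = 1 * ((16 ^ (n + 1) : ℕ) : ℝ) := by
            push_cast
            rw [← mul_pow, ← mul_pow]
            norm_num
    · rw [card_dyadicOdd]
      push_cast
      have hx : (0 : ℝ) ≤ 4 ^ (n + 1) := by positivity
      have hx1 : (1 : ℝ) ≤ 4 ^ (n + 1) := one_le_pow₀ (by norm_num)
      have hn : (0 : ℝ) < n + 1 := by positivity
      rw [div_le_iff₀ (by positivity)]
      have ht := abs_nonneg t
      have e1 : (1 : ℝ) / (n + 1) * (n + 1) = 1 := by field_simp
      have e2 : 0 < (1 : ℝ) / (n + 1) := by positivity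
      have : (1 + |t|) * (1 / ((n : ℝ) + 1)) * (1 + 2 * ((n + 1) * 4 ^ (n + 1))) =
          (1 + |t|) * (1 / ((n : ℝ) + 1)) + 2 * (1 + |t|) * 4 ^ (n + 1) := by
        linear_combination (2 * (1 + |t|) * 4 ^ (n + 1)) * e1
      have e3 : 2 * (((n : ℝ) + 1) * 4 ^ (n + 1)) * (1 / (n + 1) * |t|) =
          2 * |t| * 4 ^ (n + 1) := by
        linear_combination (2 * |t| * 4 ^ (n + 1)) * e1
      rw [this, e3]
      nlinarith [mul_nonneg (add_nonneg zero_le_one ht) e2.le]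
  simpa using (h2.mul h1).congr fun n => (CantorMoranData.charFun_nu_eq_mul _ n t).symm

theorem tendstoUniformlyOn_fourierTransform_nu_dyadicOddData :
    TendstoUniformlyOn (fun n => fourierTransform (dyadicOddData.nu n))
      (fourierTransform rhoMeasure) atTop {ξ : ℝ | ∃ k : ℤ, ξ = 1 / 2 + k} := by
  rw [Metric.tendstoUniformlyOn_iff]
  intro ε hε
  have hlim : Tendsto (fun n : ℕ => 14 * (1 / ((n : ℝ) + 1))) atTop (𝓝 0) := by
    simpa using tendsto_one_div_add_atTop_nhds_zero_nat.const_mul (14 : ℝ)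
  filter_upwards [hlim.eventually (gt_mem_nhds hε)] with n hn
  rintro _ ⟨k, rfl⟩
  rw [fourierTransform_rhoMeasure_half_add_int, dist_zero_left, fourierTransform_eq_charFun]
  refine (norm_charFun_nu_dyadicOddData_le n (exp_neg_two_pi_mul_half_add_int k)).trans_lt ?_
  rwa [div_eq_mul_one_div]

theorem theorem1p7 :
    (∃ D : CantorMoranData, ¬ ∃ φ : ℕ → ℕ, StrictMono φ ∧
        IsEquiPositive (Set.range fun k => D.nu (φ k))) ∧
    (∃ D : CantorMoranData,
        (∀ n, (D.nu n : Measure ℝ) (Set.Icc 0 1)ᶜ = 0) ∧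
        Tendsto D.nu atTop (𝓝 rhoMeasure) ∧
        TendstoUniformlyOn (fun n => fourierTransform (D.nu n)) (fourierTransform rhoMeasure) atTop
          {ξ : ℝ | ∃ k : ℤ, ξ = 1 / 2 + k}) :=
  ⟨⟨dyadicOddData, not_isEquiPositive_of_tendstoUniformlyOn
      tendstoUniformlyOn_fourierTransform_nu_dyadicOddData⟩,
    dyadicOddData, fun n => mem_ae_iff.1 (dyadicOddData.ae_nu_mem_Icc n),
    tendsto_nu_dyadicOddData, tendstoUniformlyOn_fourierTransform_nu_dyadicOddData⟩
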